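/- All groups are discrete. A group $G$ is \emph{amenable} if $\ell^\infty(G)$ has a left invariant mean. For unitary representations $\pi,\rho$ of $G$, $\pi$ is \emph{weakly contained} in $\rho$ if every diagonal matrix coefficient $g\mapsto\langle\pi(g)\xi,\xi\rangle$ is a limit, uniformly on finite subsets of $G$, of finite sums of diagonal matrix coefficients of $\rho$. For a family $\mathcal L$ of subgroups of $G$, $G$ has \emph{property $(\tau)$ with respect to $\mathcal L$} if the trivial representation is not an accumulation point of $\rho=\bigoplus_{H\in\mathcal L}\ell^2(G/H)$, i.e. there are a finite $F\subset G$ and $\varepsilon>0$ such that every non-zero vector $\xi$ orthogonal to the $\rho(G)$-invariant vectors satisfies $\max_{g\in F}\|\rho(g)\xi-\xi\|\ge\varepsilon\|\xi\|$. A trace preserving action $\sigma$ of a group $\Gamma$ on a finite von Neumann algebra $(M,\tau)$ is \emph{strongly ergodic} if every norm bounded sequence $(x_n)$ in $M$ with $\|\sigma_g(x_n)-x_n\|_2\to0$ for all $g\in\Gamma$ satisfies $\|x_n-\tau(x_n)1\|_2\to 0$, where $\|x\|_2=\tau(x^*x)^{1/2}$; a measure preserving action on a probability space $(X,\mu)$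 is strongly ergodic if the induced action on $L^\infty(X,\mu)$ with the trace $\int\cdot\,d\mu$ is. \textbf{Theorem.} Let $G$ be a non-amenable group and $\{H_i\}_i$ the family of all amenable subgroups of $G$. (1) The trivial representation of $G$ is not weakly contained in $\bigoplus_i\ell^2(G/H_i)$, nor in $\bigl(\bigoplus_i\ell^2(G/H_i)\bigr)\overline{\otimes}\,\ell^2(\mathbb N)$ (with $G$ acting trivially on $\ell^2(\mathbb N)$). (2) $G$ has property $(\tau)$ with respect to the family of its amenable subgroups. (3) Let $G$ act by automorphisms on a group $N$ so that the stabilizer in $G$ of each $h\in N\setminus\{e\}$ is amenable. Then for every non-amenable subgroup $\Gamma\subset G$ the action of $\Gamma$ on the group von Neumann algebra $L(N)$ with its canonical trace, determined by $\sigma_g(\lambda_h)=\lambda_{g(h)}$, is (trace preserving and) strongly ergodic. (4) If $\Gamma\subset SL(2,\mathbb Z)$ is a non-amenable subgroup, then the restriction to $\Gamma$ of the canonical action of $SL(2,\mathbb Z)$ on $\mathbb T^2=(\mathbb R/\mathbb Z)^2$ with its Haar probability measure is (measure preserving and) strongly ergodic. -/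

import Mathlib

open scoped ENNReal InnerProductSpace TensorProduct MatrixGroups
open Filter Topology MeasureTheory

noncomputable section

/-! ### Amenability -/

/-- A discrete group is amenable if there is a left invariant mean on `ℓ^∞(G, ℝ)`: a positive
linear functional of value `1` at the constant function `1`, invariant under left translations. -/
def IsAmenableGroup (G : Type*) [Group G] : Prop :=
  ∃ m : lp (fun _ : G => ℝ) ∞ →ₗ[ℝ] ℝ,
    m 1 = 1 ∧
    (∀ f : lp (fun _ : G => ℝ) ∞, (∀ x, 0 ≤ f x) → 0 ≤ m f) ∧
    ∀ (g : G) (f f' : lp (fun _ : G => ℝ) ∞), (∀ x, f' x = f (g⁻¹ * x)) → m f' = m f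

/-! ### Unitary representations of discrete groups and weak containment -/

/-- A unitary representation of the discrete group `G` on `K`. -/
abbrev UnitaryRep (G : Type*) [Group G] (K : Type*) [NormedAddCommGroup K]
    [InnerProductSpace ℂ K] := G →* (K ≃ₗᵢ[ℂ] K)

/-- The trivial representation of `G` on `ℂ`. -/
def trivialRep (G : Type*) [Group G] : UnitaryRep G ℂ := 1

/-- Weak containment `π ≺ ρ`: every diagonal matrix coefficient of `π` can be approximated,
uniformly on finite sets, by finite sums of diagonal matrix coefficients of `ρ`. -/
def WeaklyContained {G : Type*} [Group G]
    {K : Type*} [NormedAddCommGroup K] [InnerProductSpace ℂ K]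
    {K' : Type*} [NormedAddCommGroup K'] [InnerProductSpace ℂ K']
    (π : UnitaryRep G K) (ρ : UnitaryRep G K') : Prop :=
  ∀ (ξ : K) (F : Finset G) (ε : ℝ), 0 < ε →
    ∃ (n : ℕ) (η : Fin n → K'), ∀ g ∈ F,
      ‖⟪ξ, π g ξ⟫_ℂ - ∑ i, ⟪η i, ρ g (η i)⟫_ℂ‖ < ε

theorem memlp_two_of_norm_comp {ι κ : Type*} {E : ι → Type*} {E' : κ → Type*}
    [∀ i, NormedAddCommGroup (E i)] [∀ k, NormedAddCommGroup (E' k)]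
    (e : κ ≃ ι) (f : ∀ i, E i) (f' : ∀ k, E' k) (h : ∀ k, ‖f' k‖ = ‖f (e k)‖)
    (hf : Memℓp f 2) : Memℓp f' 2 := by
  have h2 : 0 < (2 : ℝ≥0∞).toReal := by norm_num
  rw [memℓp_gen_iff h2] at hf ⊢
  simp only [h]
  exact (e.summable_iff (f := fun i => ‖f i‖ ^ (2 : ℝ≥0∞).toReal)).2 hf

theorem norm_lp_two_of_norm_comp {ι κ : Type*} {E : ι → Type*} {E' : κ → Type*}
    [∀ i, NormedAddCommGroup (E i)] [∀ k, NormedAddCommGroup (E' k)]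
    (e : κ ≃ ι) (f : lp E 2) (f' : lp E' 2) (h : ∀ k, ‖f' k‖ = ‖f (e k)‖) : ‖f'‖ = ‖f‖ := by
  have h2 : 0 < (2 : ℝ≥0∞).toReal := by norm_num
  rw [lp.norm_eq_tsum_rpow h2, lp.norm_eq_tsum_rpow h2]
  simp only [h]
  rw [e.tsum_eq (fun i => ‖f i‖ ^ (2 : ℝ≥0∞).toReal)]

/-- The permutation representation of `G` on `ℓ²(X)`, `(g f)(x) = f (g⁻¹ x)`. -/
def permRep (G X : Type*) [Group G] [MulAction G X] :
    UnitaryRep G (lp (fun _ : X => ℂ) 2) where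
  toFun g :=
    { toFun := fun f => ⟨fun x => f (g⁻¹ • x),
        memlp_two_of_norm_comp (MulAction.toPerm g⁻¹) f _ (fun _ => rfl) (lp.memℓp f)⟩
      invFun := fun f => ⟨fun x => f (g • x),
        memlp_two_of_norm_comp (MulAction.toPerm g) f _ (fun _ => rfl) (lp.memℓp f)⟩
      map_add' := fun _ _ => rfl
      map_smul' := fun _ _ => rfl
      left_inv := fun f => by ext x; simp
      right_inv := fun f => by ext x; simp
      norm_map' := fun f =>
        norm_lp_two_of_norm_comp (MulAction.toPerm g⁻¹) f _ (fun _ => rfl) }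
  map_one' := by ext f x; simp
  map_mul' g h := by
    ext f x
    change f ((g * h)⁻¹ • x) = f (h⁻¹ • (g⁻¹ • x))
    rw [mul_inv_rev, mul_smul]

/-- The Hilbert direct sum of a family of unitary representations. -/
def directSumRep {G ι : Type*} [Group G] {E : ι → Type*} [∀ i, NormedAddCommGroup (E i)]
    [∀ i, InnerProductSpace ℂ (E i)] (π : ∀ i, UnitaryRep G (E i)) :
    UnitaryRep G (lp E 2) where
  toFun g :=
    { toFun := fun f => ⟨fun i => π i g (f i),
        memlp_two_of_norm_comp (Equiv.refl ι) f _ (fun i => LinearIsometryEquiv.norm_map _ (f i)) (lp.memℓp f)⟩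
      invFun := fun f => ⟨fun i => (π i g).symm (f i),
        memlp_two_of_norm_comp (Equiv.refl ι) f _ (fun i => LinearIsometryEquiv.norm_map _ (f i)) (lp.memℓp f)⟩
      map_add' := fun f f' => by ext i; exact map_add (π i g) (f i) (f' i)
      map_smul' := fun c f => by ext i; exact map_smul (π i g) c (f i)
      left_inv := fun f => by ext i; simp
      right_inv := fun f => by ext i; simp
      norm_map' := fun f =>
        norm_lp_two_of_norm_comp (Equiv.refl ι) f _ (fun i => LinearIsometryEquiv.norm_map _ (f i)) }
  map_one' := by ext f i; simp
  map_mul' g h := by ext f i; simp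

/-- The representation `⊕_{H ∈ L} ℓ²(G/H)`. -/
def sumQuasiRegularRep {G : Type*} [Group G] (L : Set (Subgroup G)) :
    UnitaryRep G (lp (fun H : L => lp (fun _ : G ⧸ (H : Subgroup G) => ℂ) 2) 2) :=
  directSumRep fun H : L => permRep G (G ⧸ (H : Subgroup G))

/-- The unitary operator induced on the completion by a unitary operator. -/
def completionIsometryEquiv {V : Type*} [NormedAddCommGroup V] [InnerProductSpace ℂ V]
    (u : V ≃ₗᵢ[ℂ] V) : UniformSpace.Completion V ≃ₗᵢ[ℂ] UniformSpace.Completion V where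
  toFun := (u : V →L[ℂ] V).completion
  invFun := (u.symm : V →L[ℂ] V).completion
  map_add' := map_add _
  map_smul' := map_smul _
  left_inv x := by
    induction x using UniformSpace.Completion.induction_on with
    | hp => exact isClosed_eq (by fun_prop) continuous_id
    | ih x => simp
  right_inv x := by
    induction x using UniformSpace.Completion.induction_on with
    | hp => exact isClosed_eq (by fun_prop) continuous_id
    | ih x => simp
  norm_map' x := by
    change ‖(u : V →L[ℂ] V).completion x‖ = ‖x‖
    induction x using UniformSpace.Completion.induction_on with
    | hp => exact isClosed_eq (by fun_prop) continuous_norm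
    | ih x => simp

/-- The multiple `π ⊗ 1` of `π` on the Hilbert space tensor product `K ⊗̄ K'`, which is the
completion of the algebraic tensor product. -/
def tensorTrivialRep {G : Type*} [Group G]
    {K : Type*} [NormedAddCommGroup K] [InnerProductSpace ℂ K] (π : UnitaryRep G K)
    (K' : Type*) [NormedAddCommGroup K'] [InnerProductSpace ℂ K'] :
    UnitaryRep G (UniformSpace.Completion (K ⊗[ℂ] K')) where
  toFun g := completionIsometryEquiv ((π g).rTensor K')
  map_one' := by
    ext x
    change ((((π 1).rTensor K' : (K ⊗[ℂ] K') ≃ₗᵢ[ℂ] (K ⊗[ℂ] K')) :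
      (K ⊗[ℂ] K') →L[ℂ] (K ⊗[ℂ] K')).completion) x = x
    induction x using UniformSpace.Completion.induction_on with
    | hp => exact isClosed_eq (by fun_prop) continuous_id
    | ih x =>
      simp only [ContinuousLinearMap.completion_apply_coe]
      congr 1
      induction x with
      | zero => simp
      | tmul a b => simp
      | add a b ha hb => rw [map_add, ha, hb]
  map_mul' g h := by
    ext x
    change ((((π (g * h)).rTensor K' : (K ⊗[ℂ] K') ≃ₗᵢ[ℂ] (K ⊗[ℂ] K')) :
        (K ⊗[ℂ] K') →L[ℂ] (K ⊗[ℂ] K')).completion) x =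
      ((((π g).rTensor K' : (K ⊗[ℂ] K') ≃ₗᵢ[ℂ] (K ⊗[ℂ] K')) :
        (K ⊗[ℂ] K') →L[ℂ] (K ⊗[ℂ] K')).completion)
      (((((π h).rTensor K' : (K ⊗[ℂ] K') ≃ₗᵢ[ℂ] (K ⊗[ℂ] K')) :
        (K ⊗[ℂ] K') →L[ℂ] (K ⊗[ℂ] K')).completion) x)
    induction x using UniformSpace.Completion.induction_on with
    | hp => exact isClosed_eq (by fun_prop) (by fun_prop)
    | ih x =>
      simp only [ContinuousLinearMap.completion_apply_coe]
      congr 1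
      induction x with
      | zero => simp
      | tmul a b => simp
      | add a b ha hb => simp only [map_add] at ha hb ⊢; rw [ha, hb]

/-- The closed subspace of invariant vectors of a unitary representation. -/
def invariantVectors {G : Type*} [Group G]
    {K : Type*} [NormedAddCommGroup K] [InnerProductSpace ℂ K] (π : UnitaryRep G K) :
    Submodule ℂ K where
  carrier := {ξ | ∀ g, π g ξ = ξ}
  add_mem' := fun ha hb g => by rw [map_add, ha g, hb g]
  zero_mem' := fun g => map_zero _
  smul_mem' := fun c _ ha g => by rw [map_smul, ha g]

/-- Property `(τ)` of `G` with respect to a family `L` of subgroups: the trivial representation is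
not an accumulation point of `⊕_{H ∈ L} ℓ²(G/H)`. That is, some neighbourhood of the trivial
representation (given by a finite set `F` and `ε > 0`) contains nothing of
`⊕_{H ∈ L} ℓ²(G/H)` besides the copies of the trivial representation itself. -/
def HasPropertyTau (G : Type*) [Group G] (L : Set (Subgroup G)) : Prop :=
  ∃ (F : Finset G) (ε : ℝ), 0 < ε ∧
    ∀ ξ ∈ (invariantVectors (sumQuasiRegularRep L))ᗮ, ξ ≠ 0 →
      ∃ g ∈ F, ε * ‖ξ‖ ≤ ‖sumQuasiRegularRep L g ξ - ξ‖

/-! ### The group von Neumann algebra, its trace, and actions on it -/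

/-- A unitary representation, with values in the unitary group of the algebra of operators. -/
def UnitaryRep.toUnitary {G K : Type*} [Group G] [NormedAddCommGroup K]
    [InnerProductSpace ℂ K] [CompleteSpace K] (π : UnitaryRep G K) : G →* unitary (K →L[ℂ] K) :=
  (Unitary.linearIsometryEquiv (𝕜 := ℂ) (H := K)).symm.toMonoidHom.comp π

/-- The left regular representation of `N` as unitary operators `λ_h` on `ℓ²(N)`. -/
def leftRegular (N : Type*) [Group N] :
    N →* unitary (lp (fun _ : N => ℂ) 2 →L[ℂ] lp (fun _ : N => ℂ) 2) :=
  (permRep N N).toUnitary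

/-- The set `{λ_h | h ∈ N}` of bounded operators on `ℓ²(N)`. -/
def leftRegularSet (N : Type*) [Group N] :
    Set (lp (fun _ : N => ℂ) 2 →L[ℂ] lp (fun _ : N => ℂ) 2) :=
  Set.range fun h : N => (leftRegular N h).1

/-- The group von Neumann algebra `L(N) = {λ_h | h ∈ N}''` on `ℓ²(N)`. -/
def groupVN (N : Type*) [Group N] : VonNeumannAlgebra (lp (fun _ : N => ℂ) 2) where
  toStarSubalgebra := StarSubalgebra.centralizer ℂ
    (StarSubalgebra.centralizer ℂ (leftRegularSet N) :
      Set (lp (fun _ : N => ℂ) 2 →L[ℂ] lp (fun _ : N => ℂ) 2))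
  centralizer_centralizer' := by
    have h := StarSubalgebra.coe_centralizer_centralizer ℂ (leftRegularSet N)
    refine (congrArg (fun S => Set.centralizer (Set.centralizer S)) h).trans ?_
    refine Eq.trans ?_ h.symm
    simp

/-- The canonical trace `τ(x) = ⟨x δ_e, δ_e⟩` on `L(N)`. -/
def groupVNTrace (N : Type*) [Group N] (x : (groupVN N).toStarSubalgebra) : ℂ := by
  classical
  exact ⟪lp.single 2 (1 : N) (1 : ℂ),
    (x : lp (fun _ : N => ℂ) 2 →L[ℂ] lp (fun _ : N => ℂ) 2) (lp.single 2 (1 : N) (1 : ℂ))⟫_ℂ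

/-- The unitary operators on `ℓ²(N)` that permute the coordinates by an action of `G` on `N` by
automorphisms. -/
def autUnitary (G N : Type*) [Group G] [Group N] [MulDistribMulAction G N] :
    G →* unitary (lp (fun _ : N => ℂ) 2 →L[ℂ] lp (fun _ : N => ℂ) 2) :=
  (permRep G N).toUnitary

theorem toUnitary_permRep_apply {G X : Type*} [Group G] [MulAction G X] (g : G)
    (f : lp (fun _ : X => ℂ) 2) (x : X) :
    ((permRep G X).toUnitary g : lp (fun _ : X => ℂ) 2 →L[ℂ] lp (fun _ : X => ℂ) 2) f x =
      f (g⁻¹ • x) := rfl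

theorem autUnitary_mul_leftRegular {G N : Type*} [Group G] [Group N] [MulDistribMulAction G N]
    (g : G) (h : N) :
    autUnitary G N g * leftRegular N h = leftRegular N (g • h : N) * autUnitary G N g := by
  ext f x
  change f (h⁻¹ • (g⁻¹ • x)) = f (g⁻¹ • ((g • h)⁻¹ • x))
  simp only [smul_eq_mul, smul_mul', smul_inv', inv_smul_smul]

theorem conj_leftRegular {G N : Type*} [Group G] [Group N] [MulDistribMulAction G N]
    (g : G) (h : N) :
    Unitary.conjStarAlgAut ℂ _ (autUnitary G N g) (leftRegular N h).1 =
      (leftRegular N (g • h)).1 := by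
  have e : autUnitary G N g * leftRegular N h * star (autUnitary G N g) =
      leftRegular N (g • h) := by
    rw [autUnitary_mul_leftRegular, mul_assoc, Unitary.mul_star_self, mul_one]
  exact congrArg Subtype.val e

theorem conj_mem_centralizer {A : Type*} [Ring A] [StarRing A] [Algebra ℂ A] [StarModule ℂ A]
    (φ : A ≃⋆ₐ[ℂ] A) {S : Set A} (hS : ∀ s ∈ S, φ.symm s ∈ S)
    {x : A} (hx : x ∈ StarSubalgebra.centralizer ℂ S) :
    φ x ∈ StarSubalgebra.centralizer ℂ S := by
  rw [StarSubalgebra.mem_centralizer_iff] at hx ⊢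
  intro s hs
  obtain ⟨h1, h2⟩ := hx _ (hS s hs)
  constructor
  · simpa using congrArg φ h1
  · have := congrArg φ h2
    rw [← map_star] at this
    simpa using this

theorem conj_mem_groupVN {G N : Type*} [Group G] [Group N] [MulDistribMulAction G N] (g : G)
    {x : lp (fun _ : N => ℂ) 2 →L[ℂ] lp (fun _ : N => ℂ) 2}
    (hx : x ∈ (groupVN N).toStarSubalgebra) :
    Unitary.conjStarAlgAut ℂ _ (autUnitary G N g) x ∈ (groupVN N).toStarSubalgebra := by
  refine conj_mem_centralizer (Unitary.conjStarAlgAut ℂ _ (autUnitary G N g))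
    (S := (StarSubalgebra.centralizer ℂ (leftRegularSet N) : Set _)) (fun y hy => ?_) hx
  refine conj_mem_centralizer (Unitary.conjStarAlgAut ℂ _ (autUnitary G N g)).symm
    (S := leftRegularSet N) (fun s hs => ?_) hy
  obtain ⟨h, rfl⟩ := hs
  exact ⟨g • h, (conj_leftRegular g h).symm⟩

/-- The action of `G` on `L(N)` implemented by an action of `G` on `N` by automorphisms: the
`*`-automorphism `σ_g = Ad(U_g)`, where `U_g δ_h = δ_{g h}`, so that `σ_g(λ_h) = λ_{g h}`. -/
def groupVNAction (G N : Type*) [Group G] [Group N] [MulDistribMulAction G N] :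
    G →* ((groupVN N).toStarSubalgebra ≃⋆ₐ[ℂ] (groupVN N).toStarSubalgebra) where
  toFun g :=
    { toFun := fun x => ⟨Unitary.conjStarAlgAut ℂ _ (autUnitary G N g) x,
        conj_mem_groupVN g x.2⟩
      invFun := fun x => ⟨Unitary.conjStarAlgAut ℂ _ (autUnitary G N g⁻¹) x,
        conj_mem_groupVN g⁻¹ x.2⟩
      left_inv := fun x => by
        apply Subtype.ext
        change Unitary.conjStarAlgAut ℂ _ (autUnitary G N g⁻¹)
          (Unitary.conjStarAlgAut ℂ _ (autUnitary G N g) x) = x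
        rw [← Unitary.conjStarAlgAut_mul_apply, ← map_mul]
        simp
      right_inv := fun x => by
        apply Subtype.ext
        change Unitary.conjStarAlgAut ℂ _ (autUnitary G N g)
          (Unitary.conjStarAlgAut ℂ _ (autUnitary G N g⁻¹) x) = x
        rw [← Unitary.conjStarAlgAut_mul_apply, ← map_mul]
        simp
      map_mul' := fun x y => Subtype.ext (map_mul _ _ _)
      map_add' := fun x y => Subtype.ext (map_add _ _ _)
      map_star' := fun x => Subtype.ext (map_star _ _)
      map_smul' := fun c x => Subtype.ext (map_smul _ _ _) }
  map_one' := by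
    ext x : 2
    change Unitary.conjStarAlgAut ℂ _ (autUnitary G N 1) (x : _ →L[ℂ] _) = x
    simp
  map_mul' g h := by
    ext x : 2
    change Unitary.conjStarAlgAut ℂ _ (autUnitary G N (g * h)) (x : _ →L[ℂ] _) =
      Unitary.conjStarAlgAut ℂ _ (autUnitary G N g)
        (Unitary.conjStarAlgAut ℂ _ (autUnitary G N h) x)
    rw [map_mul, Unitary.conjStarAlgAut_mul_apply]

/-! ### Strong ergodicity -/

/-- An action `σ` of `Γ` on a `*`-algebra `M` of operators with a trace `τ` is strongly ergodic if
it preserves the trace and has no non-trivial asymptotically invariant sequences: every norm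
bounded sequence `x_n` in `M` with `‖σ_g(x_n) - x_n‖₂ → 0` for all `g` satisfies
`‖x_n - τ(x_n) 1‖₂ → 0`, where `‖x‖₂ = τ(x* x)^{1/2}`. -/
def IsStronglyErgodicOn {Γ : Type*} [Group Γ]
    {K : Type*} [NormedAddCommGroup K] [InnerProductSpace ℂ K] [CompleteSpace K]
    (M : VonNeumannAlgebra K) (τ : M.toStarSubalgebra → ℂ)
    (σ : Γ →* (M.toStarSubalgebra ≃⋆ₐ[ℂ] M.toStarSubalgebra)) : Prop :=
  (∀ g x, τ (σ g x) = τ x) ∧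
  ∀ x : ℕ → M.toStarSubalgebra, (∃ C : ℝ, ∀ n, ‖(x n : K →L[ℂ] K)‖ ≤ C) →
    (∀ g : Γ, Tendsto
      (fun n => √(τ (star (σ g (x n) - x n) * (σ g (x n) - x n))).re) atTop (𝓝 0)) →
    Tendsto
      (fun n => √(τ (star (x n - τ (x n) • 1) * (x n - τ (x n) • 1))).re) atTop (𝓝 0)

/-- A measure preserving action of `Γ` on a probability space is strongly ergodic if it has no
non-trivial asymptotically invariant sequences: every sequence `f_n` that is bounded in
`L^∞(X, μ)` and satisfies `‖f_n ∘ g⁻¹ - f_n‖₂ → 0` for all `g` satisfies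
`‖f_n - ∫ f_n dμ‖₂ → 0`. -/
def IsStronglyErgodicAction {Γ X : Type*} [Group Γ] [MeasurableSpace X] (μ : Measure X)
    (σ : Γ →* Equiv.Perm X) : Prop :=
  (∀ g, MeasurePreserving (σ g) μ μ) ∧
  ∀ f : ℕ → X → ℂ, (∀ n, AEStronglyMeasurable (f n) μ) →
    (∃ C : ℝ, ∀ n, ∀ᵐ x ∂μ, ‖f n x‖ ≤ C) →
    (∀ g : Γ, Tendsto (fun n => eLpNorm (fun x => f n (σ g⁻¹ x) - f n x) 2 μ) atTop (𝓝 0)) →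
    Tendsto (fun n => eLpNorm (fun x => f n x - ∫ y, f n y ∂μ) 2 μ) atTop (𝓝 0)

/-- The canonical action of `SL(2, ℤ)` on the torus `𝕋² = (ℝ/ℤ)²` by matrix multiplication. -/
def torusAction : SL(2, ℤ) →* Equiv.Perm (UnitAddTorus (Fin 2)) where
  toFun g :=
    { toFun := fun x i => ∑ j, g.1 i j • x j
      invFun := fun x i => ∑ j, g⁻¹.1 i j • x j
      left_inv := fun x => by
        have h : g⁻¹.1 * g.1 = 1 := by
          rw [← Matrix.SpecialLinearGroup.coe_mul]; simp
        funext i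
        simp only [Finset.smul_sum, smul_smul]
        rw [Finset.sum_comm]
        simp only [← Finset.sum_smul, ← Matrix.mul_apply, h]
        simp [Matrix.one_apply]
      right_inv := fun x => by
        have h : g.1 * g⁻¹.1 = 1 := by
          rw [← Matrix.SpecialLinearGroup.coe_mul]; simp
        funext i
        simp only [Finset.smul_sum, smul_smul]
        rw [Finset.sum_comm]
        simp only [← Finset.sum_smul, ← Matrix.mul_apply, h]
        simp [Matrix.one_apply] }
  map_one' := by
    ext x i
    simp [Matrix.one_apply]
  map_mul' g h := by
    ext x i
    change ∑ j, (g * h).1 i j • x j = ∑ j, g.1 i j • ∑ k, h.1 j k • x k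
    simp only [Finset.smul_sum, smul_smul]
    rw [Finset.sum_comm]
    simp only [← Finset.sum_smul, ← Matrix.mul_apply, Matrix.SpecialLinearGroup.coe_mul]

end

/-!
Everything rests on a single principle: if a non-amenable group `G` acts on a set `X` with amenable
stabilizers, then the trivial representation of `G` is not weakly contained in `ℓ²(X)`
(`not_weaklyContained_permRep`). Indeed, if the coefficients of vectors `η i ∈ ℓ²(X)` sum up to
nearly `1` on a finite set, then the densities `∑ i, ‖η i x‖²` define approximately invariant means
on `X`, hence there is an invariant mean on `X`
(`hasInvariantMean_of_weaklyContained_permRep`). Composing it with averages over the amenable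
stabilizers gives an invariant mean on `G` (`HasInvariantMean.isAmenableGroup`).

The sum of the quasi-regular representations `ℓ²(G/H)` is `ℓ²` of the disjoint union of the `G/H`,
on which the stabilizers are the conjugates of the `H`. A multiple of a representation weakly
contains nothing more than the representation itself (`WeaklyContained.of_tensorTrivialRep`). The
absence of weak containment of the trivial representation is a spectral gap
(`exists_spectralGap_of_not_weaklyContained`), which is stronger than property `(τ)`.

For strong ergodicity, let a non-amenable group act on `X` with a fixed point `x₀` and amenable
stabilizers elsewhere. By the spectral gap on the complement of `x₀`, asymptotically invariant
sequences in `ℓ²(X)` concentrate at `x₀`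
(`tendsto_norm_sub_single_of_asymptoticallyInvariant`). For the group von Neumann algebra of `N`,
this applies to `X = N` and `x₀ = 1`, since `x ↦ x δ_1` is an equivariant embedding of `L(N)` in
`ℓ²(N)` that carries the trace to the coefficient at `1`. For the torus, it applies to the Fourier
coefficients, with `X = ℤ²` and `x₀ = 0`: the stabilizer in `SL(2, ℤ)` of a non-zero vector is
unipotent, hence embeds in `ℤ`, which is amenable.
-/

/-! ### Invariant means on sets with a group action -/

/-- The action of `G` on the set `X` admits an invariant mean: a positive unital linear functional
on `ℓ^∞(X, ℝ)` that is invariant under translations by `G`. For `G` acting on itself by left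
translations this is `IsAmenableGroup G`, by definition. -/
def HasInvariantMean (G X : Type*) [Group G] [MulAction G X] : Prop :=
  ∃ m : lp (fun _ : X => ℝ) ∞ →ₗ[ℝ] ℝ,
    m 1 = 1 ∧
    (∀ f : lp (fun _ : X => ℝ) ∞, (∀ x, 0 ≤ f x) → 0 ≤ m f) ∧
    ∀ (g : G) (f f' : lp (fun _ : X => ℝ) ∞), (∀ x, f' x = f (g⁻¹ • x)) → m f' = m f

theorem abs_le_norm_of_positive_of_unital {X : Type*} (m : lp (fun _ : X => ℝ) ∞ →ₗ[ℝ] ℝ)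
    (h1 : m 1 = 1) (hpos : ∀ f : lp (fun _ : X => ℝ) ∞, (∀ x, 0 ≤ f x) → 0 ≤ m f)
    (f : lp (fun _ : X => ℝ) ∞) : |m f| ≤ ‖f‖ := by
  have hf (x : X) : |f x| ≤ ‖f‖ := lp.norm_apply_le_norm ENNReal.top_ne_zero f x
  rw [abs_le]
  constructor
  · have := hpos (f + ‖f‖ • 1) fun x => by
      have := (abs_le.1 (hf x)).1
      change 0 ≤ f x + ‖f‖ * 1
      linarith
    simp only [map_add, map_smul, h1, smul_eq_mul] at this
    linarith
  · have := hpos (‖f‖ • 1 - f) fun x => by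
      have := (abs_le.1 (hf x)).2
      change 0 ≤ ‖f‖ * 1 - f x
      linarith
    simp only [map_sub, map_smul, h1, smul_eq_mul] at this
    linarith

/-- Composition with a map `Y → X`, as a linear map `ℓ^∞(X) → ℓ^∞(Y)`. -/
noncomputable def lpInftyComp {X Y : Type*} (φ : Y → X) :
    lp (fun _ : X => ℝ) ∞ →ₗ[ℝ] lp (fun _ : Y => ℝ) ∞ where
  toFun f := ⟨fun y => f (φ y), memℓp_infty ⟨‖f‖, by
    rintro _ ⟨y, rfl⟩
    exact lp.norm_apply_le_norm ENNReal.top_ne_zero f (φ y)⟩⟩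
  map_add' _ _ := rfl
  map_smul' _ _ := rfl

/-- If the action on `X` has an invariant mean and all stabilizers are amenable, then the group is
amenable: averaging a bounded function on `G` over the cosets of the stabilizers yields an
equivariant map `ℓ^∞(G) → ℓ^∞(X)`, along which the mean on `X` is pulled back. -/
theorem HasInvariantMean.isAmenableGroup {G X : Type*} [Group G] [MulAction G X]
    (hX : HasInvariantMean G X) (hs : ∀ x : X, IsAmenableGroup (MulAction.stabilizer G x)) :
    IsAmenableGroup G := by
  obtain ⟨M, M1, Mpos, Minv⟩ := hX
  choose m m1 mpos minv using hs
  -- Each point `x` is written as `γ x • r x` with `r x` a representative of its orbit.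
  let r : X → X := fun x => (Quotient.mk (MulAction.orbitRel G X) x).out
  have hr (x : X) : ∃ g : G, g • r x = x := by
    have : MulAction.orbitRel G X (r x) x := Quotient.mk_out (s := MulAction.orbitRel G X) x
    exact MulAction.mem_orbit_iff.1 ((MulAction.orbitRel G X).symm this)
  have hr_smul (g : G) (x : X) : r (g • x) = r x := by
    have : Quotient.mk (MulAction.orbitRel G X) (g • x) = Quotient.mk (MulAction.orbitRel G X) x :=
      Quotient.sound (s := MulAction.orbitRel G X) ⟨g, rfl⟩
    simp only [r, this]
  choose γ hγ using hr
  let A : X → G → lp (fun _ : G => ℝ) ∞ →ₗ[ℝ] ℝ := fun y k =>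
    m y ∘ₗ lpInftyComp fun h : MulAction.stabilizer G y => k * h
  have A_congr (y : X) (k k' : G) (f f' : lp (fun _ : G => ℝ) ∞) (l : G)
      (hl : ∀ x, f' x = f (l * x)) (hk : k'⁻¹ * (l * k) ∈ MulAction.stabilizer G y) :
      A y k f' = A y k' f := by
    refine minv y (⟨_, hk⟩⁻¹) _ _ fun h => ?_
    change f' (k * h) = f (k' * ↑((⟨_, hk⟩⁻¹ : MulAction.stabilizer G y)⁻¹ * h))
    rw [hl, inv_inv]
    simp [mul_assoc]
  let T : lp (fun _ : G => ℝ) ∞ →ₗ[ℝ] lp (fun _ : X => ℝ) ∞ :=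
    { toFun := fun f => ⟨fun x => A (r x) (γ x) f, memℓp_infty ⟨‖f‖, by
        rintro _ ⟨x, rfl⟩
        refine (abs_le_norm_of_positive_of_unital _ (m1 _) (mpos _) _).trans ?_
        exact lp.norm_le_of_forall_le (norm_nonneg f) fun h =>
          lp.norm_apply_le_norm ENNReal.top_ne_zero f _⟩⟩
      map_add' := fun f f' => by ext x; exact map_add (A _ _) f f'
      map_smul' := fun c f => by ext x; exact map_smul (A _ _) c f }
  refine ⟨M ∘ₗ T, ?_, fun f hf => Mpos _ fun x => mpos _ _ fun h => hf _, fun g f f' hff' => ?_⟩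
  · have : T 1 = 1 := by
      ext x
      exact m1 (r x)
    rw [LinearMap.comp_apply, this, M1]
  · refine Minv g _ _ fun x => ?_
    change A (r x) (γ x) f' = A (r (g⁻¹ • x)) (γ (g⁻¹ • x)) f
    rw [hr_smul]
    refine A_congr _ _ _ _ _ g⁻¹ hff' ?_
    have h := hγ (g⁻¹ • x)
    rw [hr_smul] at h
    rw [MulAction.mem_stabilizer_iff, mul_smul, mul_smul, hγ, inv_smul_eq_iff, h]

theorem isAmenableGroup_of_subsingleton (G : Type*) [Group G] [Subsingleton G] :
    IsAmenableGroup G := by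
  refine ⟨{ toFun := fun f => f 1, map_add' := fun _ _ => rfl, map_smul' := fun _ _ => rfl },
    rfl, fun f hf => hf 1, fun g f f' h => ?_⟩
  change f' 1 = f 1
  rw [h, Subsingleton.elim (g⁻¹ * 1) 1]

/-- Amenability passes to groups that embed in an amenable group, because such a group acts freely
with an invariant mean. -/
theorem IsAmenableGroup.of_injective {G H : Type*} [Group G] [Group H] (hG : IsAmenableGroup G)
    (φ : H →* G) (hφ : Function.Injective φ) : IsAmenableGroup H := by
  let _ : MulAction H G := MulAction.compHom G φ
  have hX : HasInvariantMean H G := by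
    obtain ⟨m, m1, mpos, minv⟩ := hG
    refine ⟨m, m1, mpos, fun g f f' h => minv (φ g) f f' fun x => ?_⟩
    rw [h, ← map_inv]
    rfl
  refine hX.isAmenableGroup fun x => ?_
  have : Subsingleton (MulAction.stabilizer H x) := by
    refine ⟨fun a b => Subtype.ext (hφ ?_)⟩
    have ha : φ a * x = x := a.2
    have hb : φ b * x = x := b.2
    exact mul_right_cancel (ha.trans hb.symm)
  exact isAmenableGroup_of_subsingleton _

/-- Approximately invariant means accumulate, along an ultrafilter, at an invariant mean. -/
theorem hasInvariantMean_of_approx {G X : Type*} [Group G] [MulAction G X]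
    (h : ∀ (F : Finset G) (ε : ℝ), 0 < ε → ∃ m : lp (fun _ : X => ℝ) ∞ →ₗ[ℝ] ℝ,
      m 1 = 1 ∧ (∀ f : lp (fun _ : X => ℝ) ∞, (∀ x, 0 ≤ f x) → 0 ≤ m f) ∧
      ∀ g ∈ F, ∀ f f' : lp (fun _ : X => ℝ) ∞, (∀ x, f' x = f (g⁻¹ • x)) →
        |m f' - m f| ≤ ε * ‖f‖) :
    HasInvariantMean G X := by
  classical
  choose m m1 mpos minv using
    fun i : Finset G × ℕ => h i.1 (1 / ((i.2 : ℝ) + 1)) Nat.one_div_pos_of_nat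
  let U : Ultrafilter (Finset G × ℕ) := Ultrafilter.of atTop
  have hU : (U : Filter (Finset G × ℕ)) ≤ atTop := Ultrafilter.of_le _
  have hlim (f : lp (fun _ : X => ℝ) ∞) : ∃ a, Tendsto (fun i => m i f) U (𝓝 a) := by
    obtain ⟨a, -, ha⟩ := (isCompact_Icc (a := -‖f‖) (b := ‖f‖)).ultrafilter_le_nhds
      (U.map fun i => m i f) (by
        refine tendsto_principal.2 (Eventually.of_forall fun i => ?_)
        exact abs_le.1 (abs_le_norm_of_positive_of_unital _ (m1 i) (mpos i) f))
    exact ⟨a, ha⟩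
  choose L hL using hlim
  refine ⟨{ toFun := L, map_add' := fun f f' => ?_, map_smul' := fun c f => ?_ }, ?_,
    fun f hf => ?_, fun g f f' hff' => ?_⟩
  · refine tendsto_nhds_unique (hL _) (((hL f).add (hL f')).congr fun i => ?_)
    rw [map_add]
  · refine tendsto_nhds_unique (hL _) (((hL f).const_mul c).congr fun i => ?_)
    rw [map_smul, smul_eq_mul]
  · refine tendsto_nhds_unique (hL _) (tendsto_const_nhds.congr fun i => (m1 i).symm)
  · exact ge_of_tendsto' (hL f) fun i => mpos i f hf
  · have hz : Tendsto (fun i : Finset G × ℕ => 1 / ((i.2 : ℝ) + 1) * ‖f‖) U (𝓝 0) := by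
      have : Tendsto (fun i : Finset G × ℕ => 1 / ((i.2 : ℝ) + 1) * ‖f‖) atTop (𝓝 (0 * ‖f‖)) :=
        ((tendsto_one_div_add_atTop_nhds_zero_nat (𝕜 := ℝ)).comp
          (by rw [← prod_atTop_atTop_eq]; exact tendsto_snd)).mul_const _
      rw [zero_mul] at this
      exact this.mono_left hU
    have hd : Tendsto (fun i => m i f' - m i f) U (𝓝 0) := by
      refine squeeze_zero_norm' ?_ hz
      have : ∀ᶠ i : Finset G × ℕ in U, ({g}, 0) ≤ i := hU (eventually_ge_atTop _)
      filter_upwards [this] with i hi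
      exact minv i g (hi.1 (Finset.mem_singleton_self g)) f f' hff'
    exact sub_eq_zero.1 (tendsto_nhds_unique ((hL f').sub (hL f)) hd)

/-- The group `ℤ` is amenable: the averages over the intervals `[0, n)` are approximately
invariant. -/
theorem isAmenableGroup_multiplicative_int : IsAmenableGroup (Multiplicative ℤ) := by
  refine hasInvariantMean_of_approx fun F ε hε => ?_
  obtain ⟨C, hC⟩ : ∃ C : ℕ, ∀ g ∈ F, (Multiplicative.toAdd g).natAbs ≤ C :=
    ⟨F.sup fun g => (Multiplicative.toAdd g).natAbs, fun g hg =>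
      Finset.le_sup (f := fun g => (Multiplicative.toAdd g).natAbs) hg⟩
  obtain ⟨n, hn⟩ := exists_nat_gt (2 * C / ε)
  have hn0 : (0 : ℝ) < n := lt_of_le_of_lt (by positivity) hn
  let m : lp (fun _ : Multiplicative ℤ => ℝ) ∞ →ₗ[ℝ] ℝ :=
    { toFun := fun f => (∑ k ∈ Finset.Ico (0 : ℤ) n, f (Multiplicative.ofAdd k)) / n
      map_add' := fun f f' => by
        rw [← add_div, ← Finset.sum_add_distrib]
        rfl
      map_smul' := fun c f => by
        rw [RingHom.id_apply, smul_eq_mul, ← mul_div_assoc, Finset.mul_sum]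
        rfl }
  refine ⟨m, ?_, fun f hf => div_nonneg (Finset.sum_nonneg fun k _ => hf _) hn0.le,
    fun g hg f f' hff' => ?_⟩
  · change (∑ k ∈ Finset.Ico (0 : ℤ) n, (1 : ℝ)) / n = 1
    simp [hn0.ne']
  · set z : ℤ := Multiplicative.toAdd g
    have hf (k : ℤ) : |f (Multiplicative.ofAdd k)| ≤ ‖f‖ :=
      lp.norm_apply_le_norm ENNReal.top_ne_zero f _
    have key (S : Finset ℤ) (hS : S.card ≤ C) :
        |∑ k ∈ S, f (Multiplicative.ofAdd k)| ≤ C * ‖f‖ := by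
      refine (Finset.abs_sum_le_sum_abs _ _).trans ?_
      refine (Finset.sum_le_card_nsmul _ _ _ fun k _ => hf k).trans ?_
      rw [nsmul_eq_mul]
      gcongr
    have h1 : ∑ k ∈ Finset.Ico (0 : ℤ) n, f' (Multiplicative.ofAdd k) =
        ∑ k ∈ Finset.Ico (-z) (n - z), f (Multiplicative.ofAdd k) := by
      have : Finset.Ico (-z) (n - z) = (Finset.Ico (0 : ℤ) n).map (addRightEmbedding (-z)) := by
        rw [Finset.map_add_right_Ico]
        simp [sub_eq_add_neg]
      rw [this, Finset.sum_map]
      refine Finset.sum_congr rfl fun k _ => ?_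
      rw [hff']
      exact congrArg (fun k : ℤ => f (Multiplicative.ofAdd k)) (show -z + k = k + -z by ring)
    change |(∑ k ∈ Finset.Ico (0 : ℤ) n, f' (Multiplicative.ofAdd k)) / n -
      (∑ k ∈ Finset.Ico (0 : ℤ) n, f (Multiplicative.ofAdd k)) / n| ≤ _
    have hz : z.natAbs ≤ C := hC g hg
    rw [← sub_div, h1, ← Finset.sum_sdiff_sub_sum_sdiff, abs_div, abs_of_pos hn0, div_le_iff₀ hn0]
    -- The two intervals differ by at most `|z|` points on either side.
    have hA : (Finset.Ico (-z) (n - z) \ Finset.Ico (0 : ℤ) n).card ≤ C := by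
      refine le_trans (Finset.card_le_card
        (t := if 0 ≤ z then Finset.Ico (-z) 0 else Finset.Ico (n : ℤ) (n - z)) ?_) ?_
      · intro k hk
        simp only [Finset.mem_sdiff, Finset.mem_Ico] at hk
        split_ifs <;> simp only [Finset.mem_Ico] <;> omega
      · split_ifs <;> simp only [Int.card_Ico] <;> omega
    have hB : (Finset.Ico (0 : ℤ) n \ Finset.Ico (-z) (n - z)).card ≤ C := by
      refine le_trans (Finset.card_le_card
        (t := if 0 ≤ z then Finset.Ico (n - z : ℤ) n else Finset.Ico 0 (-z)) ?_) ?_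
      · intro k hk
        simp only [Finset.mem_sdiff, Finset.mem_Ico] at hk
        split_ifs <;> simp only [Finset.mem_Ico] <;> omega
      · split_ifs <;> simp only [Int.card_Ico] <;> omega
    refine (abs_sub _ _).trans ((add_le_add (key _ hA) (key _ hB)).trans ?_)
    rw [div_lt_iff₀ hε] at hn
    nlinarith [norm_nonneg f]

/-! ### Weak containment of the trivial representation -/

theorem hasSum_sq_norm_lp_two {ι : Type*} {E : ι → Type*} [∀ i, NormedAddCommGroup (E i)]
    (f : lp E 2) : HasSum (fun i => ‖f i‖ ^ 2) (‖f‖ ^ 2) := by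
  simpa using lp.hasSum_norm (p := 2) (by norm_num) f

/-- A linear isometry that intertwines two representations transports matrix coefficients. -/
theorem WeaklyContained.of_intertwiner {G : Type*} [Group G]
    {K₀ K K' : Type*} [NormedAddCommGroup K₀] [InnerProductSpace ℂ K₀]
    [NormedAddCommGroup K] [InnerProductSpace ℂ K] [NormedAddCommGroup K'] [InnerProductSpace ℂ K']
    {π : UnitaryRep G K₀} {ρ : UnitaryRep G K} {ρ' : UnitaryRep G K'} (h : WeaklyContained π ρ)
    (V : K →ₗᵢ[ℂ] K') (hV : ∀ g ξ, V (ρ g ξ) = ρ' g (V ξ)) : WeaklyContained π ρ' := by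
  intro ξ F ε hε
  obtain ⟨n, η, hη⟩ := h ξ F ε hε
  refine ⟨n, fun i => V (η i), fun g hg => ?_⟩
  simpa only [← hV, V.inner_map_map] using hη g hg

/-- If the trivial representation is not weakly contained in `π`, then no non-zero vector is almost
invariant under `π`. -/
theorem exists_spectralGap_of_not_weaklyContained {G : Type*} [Group G]
    {K : Type*} [NormedAddCommGroup K] [InnerProductSpace ℂ K] {π : UnitaryRep G K}
    (h : ¬ WeaklyContained (trivialRep G) π) :
    ∃ (F : Finset G) (ε : ℝ), 0 < ε ∧ ∀ ξ : K, ξ ≠ 0 → ∃ g ∈ F, ε * ‖ξ‖ ≤ ‖π g ξ - ξ‖ := by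
  contrapose! h
  intro z F ε hε
  obtain ⟨ξ, hξ0, hξ⟩ := h F (ε / (‖z‖ ^ 2 + 1)) (by positivity)
  have hn : 0 < ‖ξ‖ := norm_pos_iff.2 hξ0
  set η : K := (‖ξ‖⁻¹ : ℂ) • ξ with hη
  have hη1 : ‖η‖ = 1 := by
    rw [hη, norm_smul, norm_inv, Complex.norm_real, norm_norm, inv_mul_cancel₀ hn.ne']
  refine ⟨1, fun _ => z • η, fun g hg => ?_⟩
  have h1 : ‖η - π g η‖ < ε / (‖z‖ ^ 2 + 1) := by
    rw [norm_sub_rev, hη, map_smul, ← smul_sub, norm_smul, norm_inv, Complex.norm_real, norm_norm,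
      inv_mul_lt_iff₀ hn, mul_comm]
    exact hξ g hg
  have hηη : ⟪η, η⟫_ℂ = 1 := by
    rw [inner_self_eq_norm_sq_to_K, hη1]
    simp
  have e : ⟪z, trivialRep G g z⟫_ℂ - ∑ _i : Fin 1, ⟪z • η, π g (z • η)⟫_ℂ =
      (starRingEnd ℂ z * z) * ⟪η, η - π g η⟫_ℂ := by
    rw [inner_sub_right, hηη]
    simp only [trivialRep, MonoidHom.one_apply, LinearIsometryEquiv.coe_one, id_eq,
      RCLike.inner_apply, Finset.univ_unique, Finset.sum_singleton, map_smul, inner_smul_left,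
      inner_smul_right]
    ring
  rw [e, norm_mul, norm_mul, RCLike.norm_conj, ← sq]
  calc ‖z‖ ^ 2 * ‖⟪η, η - π g η⟫_ℂ‖ ≤ ‖z‖ ^ 2 * ‖η - π g η‖ := by
        gcongr
        exact (norm_inner_le_norm _ _).trans_eq (by rw [hη1, one_mul])
    _ ≤ ‖z‖ ^ 2 * (ε / (‖z‖ ^ 2 + 1)) := by gcongr
    _ < ε := by
        rw [mul_div_assoc', div_lt_iff₀ (by positivity)]
        nlinarith

/-- Weak containment of the trivial representation in `ℓ²(X)` yields an invariant mean on `X`: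
the means `f ↦ ∑ i, ∑ x, f x * ‖η i x‖²`, for vectors `η i` whose matrix coefficients approximate
the constant function `1`, are approximately invariant after normalization. -/
theorem hasInvariantMean_of_weaklyContained_permRep {G X : Type*} [Group G] [MulAction G X]
    (h : WeaklyContained (trivialRep G) (permRep G X)) : HasInvariantMean G X := by
  classical
  refine hasInvariantMean_of_approx fun F ε hε => ?_
  -- The bound `1 / 2` keeps the total mass `S` away from `0`; the other one makes the total
  -- displacement `4 * δ` small enough for the final estimate.
  set δ : ℝ := min (1 / 2) (ε ^ 2 / 64) with hδ
  have hδ0 : 0 < δ := by positivity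
  have hδ1 : δ ≤ 1 / 2 := min_le_left _ _
  have hδ2 : δ ≤ ε ^ 2 / 64 := min_le_right _ _
  obtain ⟨n, η, hη⟩ := h 1 (insert 1 F) δ hδ0
  set S : ℝ := ∑ i, ‖η i‖ ^ 2 with hS
  have hcoef (g : G) (hg : g ∈ insert 1 F) :
      |1 - ∑ i, (⟪η i, permRep G X g (η i)⟫_ℂ).re| < δ := by
    have h1 := hη g hg
    refine lt_of_le_of_lt ?_ h1
    refine le_trans (le_of_eq ?_) (Complex.abs_re_le_norm _)
    congr 1
    simp [trivialRep]
  have hS1 : |1 - S| < δ := by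
    have := hcoef 1 (Finset.mem_insert_self _ _)
    simpa [hS, inner_self_eq_norm_sq_to_K, ← Complex.ofReal_pow] using this
  have hS2 : 1 / 2 ≤ S := by linarith [(abs_lt.1 hS1).2]
  have hS0 : 0 < S := by linarith
  -- The total displacement of the vectors `η i` under an element of `F`.
  have hD (g : G) (hg : g ∈ F) : ∑ i, ‖permRep G X g⁻¹ (η i) - η i‖ ^ 2 ≤ 4 * δ := by
    have e (i : Fin n) : ‖permRep G X g⁻¹ (η i) - η i‖ ^ 2 =
        2 * ‖η i‖ ^ 2 - 2 * (⟪η i, permRep G X g (η i)⟫_ℂ).re := by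
      have e1 : ‖permRep G X g⁻¹ (η i) - η i‖ = ‖η i - permRep G X g (η i)‖ := by
        have e2 : permRep G X g (permRep G X g⁻¹ (η i)) = η i := by
          change (permRep G X g * permRep G X g⁻¹) (η i) = η i
          rw [← map_mul, mul_inv_cancel, map_one, LinearIsometryEquiv.coe_one, id]
        rw [← (permRep G X g).norm_map, map_sub, e2]
      rw [e1, norm_sub_sq (𝕜 := ℂ), LinearIsometryEquiv.norm_map]
      change ‖η i‖ ^ 2 - 2 * (⟪η i, permRep G X g (η i)⟫_ℂ).re + ‖η i‖ ^ 2 = _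
      ring
    simp only [e, Finset.sum_sub_distrib, ← Finset.mul_sum, ← hS]
    have := (abs_lt.1 (hcoef g (Finset.mem_insert_of_mem hg))).2
    have := (abs_lt.1 hS1).1
    linarith
  have hb (f : lp (fun _ : X => ℝ) ∞) (x : X) : |f x| ≤ ‖f‖ :=
    lp.norm_apply_le_norm ENNReal.top_ne_zero f x
  have hsum (f : lp (fun _ : X => ℝ) ∞) (ζ : lp (fun _ : X => ℂ) 2) :
      Summable fun x => f x * ‖ζ x‖ ^ 2 := by
    refine Summable.of_norm_bounded ((hasSum_sq_norm_lp_two ζ).summable.mul_left ‖f‖) fun x => ?_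
    rw [norm_mul, norm_pow, norm_norm]
    gcongr
    exact hb f x
  let m : lp (fun _ : X => ℝ) ∞ →ₗ[ℝ] ℝ :=
    { toFun := fun f => (∑ i, ∑' x, f x * ‖η i x‖ ^ 2) / S
      map_add' := fun f f' => by
        rw [← add_div, ← Finset.sum_add_distrib]
        congr 1
        refine Finset.sum_congr rfl fun i _ => ?_
        rw [← (hsum f _).tsum_add (hsum f' _)]
        exact tsum_congr fun x => add_mul (f x) (f' x) _
      map_smul' := fun c f => by
        rw [RingHom.id_apply, smul_eq_mul, ← mul_div_assoc, Finset.mul_sum]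
        congr 1
        refine Finset.sum_congr rfl fun i _ => ?_
        rw [← tsum_mul_left]
        exact tsum_congr fun x => mul_assoc c (f x) _ }
  refine ⟨m, ?_, fun f hf => div_nonneg (Finset.sum_nonneg fun i _ => tsum_nonneg fun x =>
    mul_nonneg (hf x) (sq_nonneg _)) hS0.le, fun g hg f f' hff' => ?_⟩
  · change (∑ i, ∑' x, (1 : ℝ) * ‖η i x‖ ^ 2) / S = 1
    simp only [one_mul, fun i => (hasSum_sq_norm_lp_two (η i)).tsum_eq]
    exact div_self hS0.ne'
  · -- By the inequality of arithmetic and geometric means,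
    -- `|‖z‖² - ‖w‖²| ≤ (2 / ε) ‖z - w‖² + (ε / 4) (‖z‖² + ‖w‖²)`.
    have hpt (z w : ℂ) : |‖z‖ ^ 2 - ‖w‖ ^ 2| ≤
        2 / ε * ‖z - w‖ ^ 2 + ε / 4 * (‖z‖ ^ 2 + ‖w‖ ^ 2) := by
      have h1 : |‖z‖ - ‖w‖| ≤ ‖z - w‖ := abs_norm_sub_norm_le z w
      have h2 : |‖z‖ ^ 2 - ‖w‖ ^ 2| = |‖z‖ - ‖w‖| * (‖z‖ + ‖w‖) := by
        rw [sq_sub_sq, abs_mul, abs_of_nonneg (by positivity : 0 ≤ ‖z‖ + ‖w‖), mul_comm]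
      rw [h2]
      calc |‖z‖ - ‖w‖| * (‖z‖ + ‖w‖) ≤ ‖z - w‖ * (‖z‖ + ‖w‖) := by gcongr
        _ ≤ 2 / ε * ‖z - w‖ ^ 2 + ε / 8 * (‖z‖ + ‖w‖) ^ 2 := by
          have : 2 / ε * ‖z - w‖ ^ 2 + ε / 8 * (‖z‖ + ‖w‖) ^ 2 - ‖z - w‖ * (‖z‖ + ‖w‖) =
              2 / ε * (‖z - w‖ - ε / 4 * (‖z‖ + ‖w‖)) ^ 2 := by
            field_simp
            ring
          have : 0 ≤ 2 / ε * (‖z - w‖ - ε / 4 * (‖z‖ + ‖w‖)) ^ 2 := by positivity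
          linarith
        _ ≤ _ := by
          have : 0 ≤ ε / 8 * (‖z‖ - ‖w‖) ^ 2 := by positivity
          nlinarith
    have hdiff (i : Fin n) :
        |∑' x, f' x * ‖η i x‖ ^ 2 - ∑' x, f x * ‖η i x‖ ^ 2| ≤
          ‖f‖ * (2 / ε * ‖permRep G X g⁻¹ (η i) - η i‖ ^ 2 + ε / 2 * ‖η i‖ ^ 2) := by
      have e1 : ∑' x, f' x * ‖η i x‖ ^ 2 = ∑' x, f x * ‖permRep G X g⁻¹ (η i) x‖ ^ 2 := by
        rw [← (MulAction.toPerm g).tsum_eq fun x => f' x * ‖η i x‖ ^ 2]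
        refine tsum_congr fun x => ?_
        have : permRep G X g⁻¹ (η i) x = η i (g⁻¹⁻¹ • x) := rfl
        rw [this, hff', inv_inv, MulAction.toPerm_apply, inv_smul_smul]
      rw [e1, ← (hsum _ _).tsum_sub (hsum _ _)]
      have hs : HasSum (fun x => ‖f‖ * (2 / ε * ‖(permRep G X g⁻¹ (η i) - η i) x‖ ^ 2 +
          ε / 4 * (‖permRep G X g⁻¹ (η i) x‖ ^ 2 + ‖η i x‖ ^ 2)))
          (‖f‖ * (2 / ε * ‖permRep G X g⁻¹ (η i) - η i‖ ^ 2 +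
            ε / 4 * (‖permRep G X g⁻¹ (η i)‖ ^ 2 + ‖η i‖ ^ 2))) :=
        (((hasSum_sq_norm_lp_two _).mul_left _).add
          (((hasSum_sq_norm_lp_two _).add (hasSum_sq_norm_lp_two _)).mul_left _)).mul_left _
      rw [LinearIsometryEquiv.norm_map] at hs
      have : ε / 4 * (‖η i‖ ^ 2 + ‖η i‖ ^ 2) = ε / 2 * ‖η i‖ ^ 2 := by ring
      rw [this] at hs
      rw [← Real.norm_eq_abs]
      refine tsum_of_norm_bounded hs fun x => ?_
      rw [← mul_sub, norm_mul]
      exact mul_le_mul (hb f x) (hpt _ _) (norm_nonneg _) (norm_nonneg _)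
    change |(∑ i, ∑' x, f' x * ‖η i x‖ ^ 2) / S - (∑ i, ∑' x, f x * ‖η i x‖ ^ 2) / S| ≤ _
    rw [← sub_div, ← Finset.sum_sub_distrib, abs_div, abs_of_pos hS0, div_le_iff₀ hS0]
    calc _ ≤ ∑ i, ‖f‖ * (2 / ε * ‖permRep G X g⁻¹ (η i) - η i‖ ^ 2 + ε / 2 * ‖η i‖ ^ 2) :=
          (Finset.abs_sum_le_sum_abs _ _).trans (Finset.sum_le_sum fun i _ => hdiff i)
      _ = ‖f‖ * (2 / ε * ∑ i, ‖permRep G X g⁻¹ (η i) - η i‖ ^ 2 + ε / 2 * S) := by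
          rw [hS, ← Finset.mul_sum, Finset.sum_add_distrib, Finset.mul_sum, Finset.mul_sum]
      _ ≤ ‖f‖ * (2 / ε * (4 * (ε ^ 2 / 64)) + ε / 2 * S) := by
          gcongr
          exact (hD g hg).trans (by linarith)
      _ = ‖f‖ * (ε / 8 + ε / 2 * S) := by
          congr 2
          field_simp
          norm_num
      _ ≤ ‖f‖ * (ε * S) := by
          gcongr
          nlinarith
      _ = ε * ‖f‖ * S := by ring

theorem not_weaklyContained_permRep {G X : Type*} [Group G] [MulAction G X]
    (hG : ¬ IsAmenableGroup G) (hs : ∀ x : X, IsAmenableGroup (MulAction.stabilizer G x)) :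
    ¬ WeaklyContained (trivialRep G) (permRep G X) := fun h =>
  hG ((hasInvariantMean_of_weaklyContained_permRep h).isAmenableGroup hs)

/-! ### Quasi-regular representations and multiples -/

theorem isAmenableGroup_stabilizer_quotient {G : Type*} [Group G] {H : Subgroup G}
    (hH : IsAmenableGroup H) (x : G ⧸ H) : IsAmenableGroup (MulAction.stabilizer G x) := by
  obtain ⟨g, rfl⟩ := QuotientGroup.mk_surjective x
  have hx (s : MulAction.stabilizer G (g : G ⧸ H)) : g⁻¹ * s * g ∈ H := by
    have h : ((s * g : G) : G ⧸ H) = g := s.2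
    rw [mul_assoc]
    exact QuotientGroup.eq.1 h.symm
  refine hH.of_injective
    { toFun := fun s => ⟨g⁻¹ * s * g, hx s⟩
      map_one' := by simp
      map_mul' := fun s t => by
        ext
        simp [mul_assoc] } fun s t hst => ?_
  have : g⁻¹ * s * g = g⁻¹ * t * g := congrArg Subtype.val hst
  exact Subtype.ext (mul_left_cancel (mul_right_cancel this))

/-- The canonical isometry from `⊕_i ℓ²(X i)` to `ℓ²` of the disjoint union of the `X i`. -/
noncomputable def lpSigmaIsometry {ι : Type*} (X : ι → Type*) :
    lp (fun i => lp (fun _ : X i => ℂ) 2) 2 →ₗᵢ[ℂ] lp (fun _ : Σ i, X i => ℂ) 2 :=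
  have key (f : lp (fun i => lp (fun _ : X i => ℂ) 2) 2) :
      HasSum (fun x : Σ i, X i => ‖f x.1 x.2‖ ^ 2) (‖f‖ ^ 2) := by
    have hi (i : ι) := hasSum_sq_norm_lp_two (f i)
    have hs : Summable fun x : Σ i, X i => ‖f x.1 x.2‖ ^ 2 := by
      refine (summable_sigma_of_nonneg fun x => sq_nonneg _).2 ⟨fun i => (hi i).summable, ?_⟩
      simpa only [fun i => (hi i).tsum_eq] using (hasSum_sq_norm_lp_two f).summable
    have := hs.hasSum.sigma hi
    rw [(hasSum_sq_norm_lp_two f).unique this]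
    exact hs.hasSum
  { toFun := fun f => ⟨fun x => f x.1 x.2, by
      refine (memℓp_gen_iff (by norm_num)).2 ?_
      simpa using (key f).summable⟩
    map_add' := fun _ _ => rfl
    map_smul' := fun _ _ => rfl
    norm_map' := fun f => by
      refine (sq_eq_sq₀ (norm_nonneg _) (norm_nonneg _)).1 ?_
      exact (hasSum_sq_norm_lp_two _).unique (key f) }

theorem not_weaklyContained_sumQuasiRegularRep {G : Type*} [Group G] (hG : ¬ IsAmenableGroup G) :
    ¬ WeaklyContained (trivialRep G)
      (sumQuasiRegularRep {H : Subgroup G | IsAmenableGroup H}) := by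
  intro h
  refine not_weaklyContained_permRep
    (X := Σ H : {H : Subgroup G | IsAmenableGroup H}, G ⧸ (H : Subgroup G)) hG ?_
    (h.of_intertwiner (lpSigmaIsometry _) fun g ξ => rfl)
  rintro ⟨H, x⟩
  refine (isAmenableGroup_stabilizer_quotient H.2 x).of_injective
    (Subgroup.inclusion fun g hg => ?_) (Subgroup.inclusion_injective _)
  have : (⟨H, g • x⟩ : Σ H : {H : Subgroup G | IsAmenableGroup H}, G ⧸ (H : Subgroup G)) = ⟨H, x⟩ :=
    hg
  simpa using this

/-- A multiple `ρ ⊗ 1` has no more diagonal coefficients, up to sums and limits, than `ρ`: if the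
vectors `e k` are orthonormal, then the coefficient of `∑ k, a k ⊗ e k` is the sum of the
coefficients of the `a k`. -/
theorem WeaklyContained.of_tensorTrivialRep {G : Type*} [Group G]
    {K₀ K : Type*} [NormedAddCommGroup K₀] [InnerProductSpace ℂ K₀]
    [NormedAddCommGroup K] [InnerProductSpace ℂ K]
    {K' : Type*} [NormedAddCommGroup K'] [InnerProductSpace ℂ K']
    {π : UnitaryRep G K₀} {ρ : UnitaryRep G K}
    (h : WeaklyContained π (tensorTrivialRep ρ K')) : WeaklyContained π ρ := by
  have algebraic (x : K ⊗[ℂ] K') : ∃ (ι : Type) (_ : Fintype ι) (a : ι → K), ∀ g,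
      ⟪(x : UniformSpace.Completion (K ⊗[ℂ] K')), tensorTrivialRep ρ K' g x⟫_ℂ =
        ∑ i, ⟪a i, ρ g (a i)⟫_ℂ := by
    obtain ⟨N, _, hN⟩ := TensorProduct.exists_finite_submodule_right_of_setFinite {x}
      (Set.finite_singleton x)
    obtain ⟨y, rfl⟩ := Set.singleton_subset_iff.1 hN
    let e := stdOrthonormalBasis ℂ N
    obtain ⟨a, ha⟩ : ∃ a : Fin (Module.finrank ℂ N) → K, y = ∑ i, a i ⊗ₜ[ℂ] e i := by
      induction y with
      | zero => exact ⟨0, by simp⟩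
      | tmul k v =>
        refine ⟨fun i => e.repr v i • k, ?_⟩
        simp only [TensorProduct.smul_tmul, ← TensorProduct.tmul_sum, e.sum_repr]
      | add y z hy hz =>
        obtain ⟨a, ha⟩ := hy (by simp)
        obtain ⟨b, hb⟩ := hz (by simp)
        exact ⟨a + b, by simp [ha, hb, TensorProduct.add_tmul, Finset.sum_add_distrib]⟩
    refine ⟨_, inferInstance, a, fun g => ?_⟩
    set x := N.subtype.lTensor K y with hx
    have hg : tensorTrivialRep ρ K' g x = ((ρ g).rTensor K' x : UniformSpace.Completion _) :=
      ContinuousLinearMap.completion_apply_coe _ _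
    rw [hg, UniformSpace.Completion.inner_coe, hx, ha]
    have hee (i j : Fin (Module.finrank ℂ N)) :
        ⟪(e i : K'), (e j : K')⟫_ℂ = if i = j then 1 else 0 :=
      orthonormal_iff_ite.1 e.orthonormal i j
    simp [sum_inner, inner_sum, hee]
  have single (ξ : UniformSpace.Completion (K ⊗[ℂ] K')) (ε : ℝ) (hε : 0 < ε) :
      ∃ (ι : Type) (_ : Fintype ι) (a : ι → K), ∀ g,
      ‖⟪ξ, tensorTrivialRep ρ K' g ξ⟫_ℂ - ∑ i, ⟪a i, ρ g (a i)⟫_ℂ‖ < ε := by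
    obtain ⟨x, hx⟩ := UniformSpace.Completion.denseRange_coe.exists_dist_lt ξ
      (show 0 < min 1 (ε / (2 * ‖ξ‖ + 2)) by positivity)
    rw [dist_eq_norm, lt_min_iff, lt_div_iff₀ (by positivity)] at hx
    obtain ⟨ι, hι, a, ha⟩ := algebraic x
    refine ⟨ι, hι, a, fun g => ?_⟩
    set u := tensorTrivialRep ρ K' g
    set x' : UniformSpace.Completion (K ⊗[ℂ] K') := UniformSpace.Completion.coe' x
    have e : ⟪ξ, u ξ⟫_ℂ - ⟪x', u x'⟫_ℂ = ⟪ξ - x', u ξ⟫_ℂ + ⟪x', u (ξ - x')⟫_ℂ := by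
      rw [inner_sub_left, map_sub, inner_sub_right]
      ring
    have hx' : ‖x'‖ ≤ ‖ξ‖ + 1 := by
      have := norm_sub_norm_le x' ξ
      rw [norm_sub_rev] at this
      linarith [hx.1]
    rw [← ha, e]
    calc _ ≤ ‖ξ - x'‖ * ‖ξ‖ + ‖x'‖ * ‖ξ - x'‖ := by
          refine (norm_add_le _ _).trans (add_le_add ?_ ?_)
          · exact (norm_inner_le_norm _ _).trans_eq (by rw [u.norm_map])
          · exact (norm_inner_le_norm _ _).trans_eq (by rw [u.norm_map])
      _ ≤ ‖ξ - x'‖ * (2 * ‖ξ‖ + 2) := by nlinarith [norm_nonneg (ξ - x')]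
      _ < ε := hx.2
  intro ξ F ε hε
  obtain ⟨n, η, hη⟩ := h ξ F (ε / 2) (half_pos hε)
  choose ι _ a ha using fun i => single (η i) (ε / (2 * (n + 1))) (by positivity)
  let e := Fintype.equivFin (Σ i, ι i)
  refine ⟨_, fun k => a _ (e.symm k).2, fun g hg => ?_⟩
  rw [e.symm.sum_comp fun k : Σ i, ι i => ⟪a _ k.2, ρ g (a _ k.2)⟫_ℂ, Fintype.sum_sigma]
  have h2 : ‖∑ i, ⟪η i, tensorTrivialRep ρ K' g (η i)⟫_ℂ -
      ∑ i, ∑ j, ⟪a i j, ρ g (a i j)⟫_ℂ‖ ≤ ε / 2 := by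
    rw [← Finset.sum_sub_distrib]
    refine (norm_sum_le_of_le _ fun i _ => (ha i g).le).trans ?_
    rw [Finset.sum_const, Finset.card_univ, Fintype.card_fin, nsmul_eq_mul, mul_div_assoc',
      div_le_div_iff₀ (by positivity) two_pos]
    nlinarith
  calc _ ≤ _ := norm_sub_le_norm_sub_add_norm_sub _ (∑ i, ⟪η i, tensorTrivialRep ρ K' g (η i)⟫_ℂ) _
    _ < ε / 2 + ε / 2 := add_lt_add_of_lt_of_le (hη g hg) h2
    _ = ε := add_halves ε

theorem hasPropertyTau_amenableSubgroups {G : Type*} [Group G] (hG : ¬ IsAmenableGroup G) :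
    HasPropertyTau G {H : Subgroup G | IsAmenableGroup H} := by
  obtain ⟨F, ε, hε, h⟩ :=
    exists_spectralGap_of_not_weaklyContained (not_weaklyContained_sumQuasiRegularRep hG)
  exact ⟨F, ε, hε, fun ξ _ hξ => h ξ hξ⟩

/-! ### Asymptotically invariant sequences in permutation representations -/

/-- Let a non-amenable group act on `X` with a fixed point `x₀`, all other stabilizers being
amenable. Then asymptotically invariant sequences in `ℓ²(X)` concentrate at `x₀`, because `ℓ²` of
the complement of `x₀` has a spectral gap. -/
theorem tendsto_norm_sub_single_of_asymptoticallyInvariant {G X : Type*} [Group G] [MulAction G X]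
    [DecidableEq X] (hG : ¬ IsAmenableGroup G) (x₀ : X) (hx₀ : ∀ g : G, g • x₀ = x₀)
    (hs : ∀ x : X, x ≠ x₀ → IsAmenableGroup (MulAction.stabilizer G x))
    (ξ : ℕ → lp (fun _ : X => ℂ) 2)
    (hξ : ∀ g : G, Tendsto (fun n => ‖permRep G X g (ξ n) - ξ n‖) atTop (𝓝 0)) :
    Tendsto (fun n => ‖ξ n - lp.single 2 x₀ (ξ n x₀)‖) atTop (𝓝 0) := by
  let Y : SubMulAction G X :=
    { carrier := {x | x ≠ x₀}
      smul_mem' := fun g x hx h => hx (by rwa [← hx₀ g, smul_left_cancel_iff] at h) }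
  have hgap := not_weaklyContained_permRep (X := Y) hG fun y => by
    rw [SubMulAction.stabilizer_of_subMul]
    exact hs y y.2
  obtain ⟨F, ε, hε, hF⟩ := exists_spectralGap_of_not_weaklyContained hgap
  -- Restriction of vectors to the complement `Y` of `x₀`.
  let R : lp (fun _ : X => ℂ) 2 → lp (fun _ : Y => ℂ) 2 := fun ζ => ⟨fun y => ζ y, by
    refine (memℓp_gen_iff (by norm_num)).2 ?_
    simpa [Function.comp_def] using (hasSum_sq_norm_lp_two ζ).summable.comp_injective
      (Subtype.val_injective (p := fun x => x ∈ Y))⟩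
  have hR (ζ : lp (fun _ : X => ℂ) 2) (hζ : ζ x₀ = 0) : ‖R ζ‖ = ‖ζ‖ := by
    refine (sq_eq_sq₀ (norm_nonneg _) (norm_nonneg _)).1 ?_
    refine (hasSum_sq_norm_lp_two (R ζ)).unique ?_
    refine (hasSum_subtype_iff_of_support_subset (s := {x | x ≠ x₀})
      (f := fun x => ‖ζ x‖ ^ 2) fun x hx => ?_).2 (hasSum_sq_norm_lp_two ζ)
    rintro rfl
    simp [hζ] at hx
  let ζ : ℕ → lp (fun _ : X => ℂ) 2 := fun n => ξ n - lp.single 2 x₀ (ξ n x₀)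
  have hζ (n : ℕ) : ζ n x₀ = 0 := by simp [ζ]
  have hsingle (g : G) (c : ℂ) : permRep G X g (lp.single 2 x₀ c) = lp.single 2 x₀ c := by
    ext x
    change (lp.single 2 x₀ c : lp (fun _ : X => ℂ) 2) (g⁻¹ • x) = _
    by_cases hx : x = x₀
    · rw [hx, hx₀]
    · have hx' : g⁻¹ • x ≠ x₀ := by rwa [Ne, inv_smul_eq_iff, hx₀]
      rw [lp.single_apply_ne _ _ _ hx, lp.single_apply_ne _ _ _ hx']
  have hdiff (g : G) (n : ℕ) : permRep G X g (ζ n) - ζ n = permRep G X g (ξ n) - ξ n := by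
    simp only [ζ, map_sub, hsingle]
    abel
  have hRdiff (g : G) (n : ℕ) :
      ‖permRep G Y g (R (ζ n)) - R (ζ n)‖ = ‖permRep G X g (ξ n) - ξ n‖ := by
    rw [← hdiff, ← hR (permRep G X g (ζ n) - ζ n)]
    · rfl
    · change ζ n (g⁻¹ • x₀) - ζ n x₀ = 0
      rw [hx₀, sub_self]
  have hbound (n : ℕ) : ‖ζ n‖ ≤ ε⁻¹ * ∑ g ∈ F, ‖permRep G X g (ξ n) - ξ n‖ := by
    rw [← hR _ (hζ n), le_inv_mul_iff₀ hε]
    by_cases h0 : R (ζ n) = 0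
    · rw [h0, norm_zero, mul_zero]
      exact Finset.sum_nonneg fun g _ => norm_nonneg _
    · obtain ⟨g, hg, h⟩ := hF _ h0
      rw [hRdiff] at h
      exact h.trans (Finset.single_le_sum
        (f := fun g => ‖permRep G X g (ξ n) - ξ n‖) (fun _ _ => norm_nonneg _) hg)
  refine squeeze_zero (fun n => norm_nonneg _) hbound ?_
  simpa using (tendsto_finsetSum F fun g _ => hξ g).const_mul ε⁻¹

theorem isAmenableGroup_stabilizer_subgroup {G X : Type*} [Group G] [MulAction G X]
    (Γ : Subgroup G) {x : X} (h : IsAmenableGroup (MulAction.stabilizer G x)) :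
    IsAmenableGroup (MulAction.stabilizer Γ x) :=
  h.of_injective
    ((Γ.subtype.comp (MulAction.stabilizer Γ x).subtype).codRestrict _ fun s => s.2)
    fun _ _ hst => Subtype.ext (Subtype.ext
      (congrArg (fun u : MulAction.stabilizer G x => (u : G)) hst))

/-! ### Strong ergodicity on group von Neumann algebras -/

theorem isStronglyErgodicOn_groupVN {G : Type*} [Group G] {N : Type*} [Group N]
    [MulDistribMulAction G N]
    (hs : ∀ h : N, h ≠ 1 → IsAmenableGroup (MulAction.stabilizer G h))
    (Γ : Subgroup G) (hΓ : ¬ IsAmenableGroup Γ) :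
    IsStronglyErgodicOn (groupVN N) (groupVNTrace N) ((groupVNAction G N).comp Γ.subtype) := by
  classical
  let δ : lp (fun _ : N => ℂ) 2 := lp.single 2 (1 : N) (1 : ℂ)
  have trace_def (x : (groupVN N).toStarSubalgebra) :
      groupVNTrace N x = ⟪δ, (x : _ →L[ℂ] lp (fun _ : N => ℂ) 2) δ⟫_ℂ := by
    simp only [groupVNTrace, δ]
  have hδ (g : G) : permRep G N g δ = δ := by
    ext x
    change δ (g⁻¹ • x) = δ x
    simp only [δ, lp.single_apply, Pi.single_apply, smul_eq_iff_eq_inv_smul, smul_one]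
  have action_apply (g : G) (x : (groupVN N).toStarSubalgebra) :
      (groupVNAction G N g x : _ →L[ℂ] lp (fun _ : N => ℂ) 2) δ =
        permRep G N g ((x : _ →L[ℂ] lp (fun _ : N => ℂ) 2) δ) := by
    have hstar : star (autUnitary G N g) = autUnitary G N g⁻¹ := by rw [map_inv]; rfl
    change Unitary.conjStarAlgAut ℂ _ (autUnitary G N g) (x : _ →L[ℂ] lp (fun _ : N => ℂ) 2) δ = _
    rw [Unitary.conjStarAlgAut_apply, ← Unitary.coe_star, hstar]
    change permRep G N g ((x : _ →L[ℂ] lp (fun _ : N => ℂ) 2) (permRep G N g⁻¹ δ)) = _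
    rw [hδ]
  have norm_two (x : (groupVN N).toStarSubalgebra) :
      √(groupVNTrace N (star x * x)).re = ‖(x : _ →L[ℂ] lp (fun _ : N => ℂ) 2) δ‖ := by
    rw [trace_def]
    change √(⟪δ, ContinuousLinearMap.adjoint (x : _ →L[ℂ] lp (fun _ : N => ℂ) 2)
      ((x : _ →L[ℂ] lp (fun _ : N => ℂ) 2) δ)⟫_ℂ).re = _
    rw [ContinuousLinearMap.adjoint_inner_right, norm_eq_sqrt_re_inner (𝕜 := ℂ)]
    rfl
  refine ⟨fun g x => ?_, fun x _ hx => ?_⟩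
  · rw [trace_def, trace_def]
    change ⟪δ, (groupVNAction G N g x : _ →L[ℂ] lp (fun _ : N => ℂ) 2) δ⟫_ℂ = _
    rw [action_apply]
    exact (congrArg (fun η => ⟪η, _⟫_ℂ) (hδ g).symm).trans
      ((permRep G N (g : G)).inner_map_map _ _)
  · simp only [norm_two] at hx ⊢
    have h := tendsto_norm_sub_single_of_asymptoticallyInvariant hΓ (1 : N) (fun g => smul_one g)
      (fun h hh => isAmenableGroup_stabilizer_subgroup Γ (hs h hh))
      (fun n => (x n : _ →L[ℂ] lp (fun _ : N => ℂ) 2) δ) fun g => by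
        refine (hx g).congr fun n => congrArg norm ?_
        exact congrArg (· - (x n : _ →L[ℂ] lp (fun _ : N => ℂ) 2) δ) (action_apply g (x n))
    refine h.congr fun n => congrArg norm ?_
    change _ = (x n : _ →L[ℂ] lp (fun _ : N => ℂ) 2) δ - groupVNTrace N (x n) • δ
    rw [trace_def, lp.inner_single_left]
    simp only [δ, ← lp.single_smul]
    simp

/-! ### The action of `SL(2, ℤ)` on the torus and on its dual -/

/-- The rotation `(v 0, v 1) ↦ (-v 1, v 0)` of `ℤ²`. It identifies the natural action of
`SL(2, ℤ)` on column vectors with the action `v ↦ v * g⁻¹` on row vectors, which is the action on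
the characters of the torus that is dual to `torusAction`. -/
def latticeRotation : Equiv.Perm (Fin 2 → ℤ) where
  toFun v := ![-v 1, v 0]
  invFun v := ![v 1, -v 0]
  left_inv v := by ext i; fin_cases i <;> simp
  right_inv v := by ext i; fin_cases i <;> simp

theorem latticeRotation_inv_smul (g : SL(2, ℤ)) (v : Fin 2 → ℤ) :
    latticeRotation (g⁻¹ • v) = Matrix.vecMul (latticeRotation v) g.1 := by
  ext i
  fin_cases i <;>
    simp [latticeRotation, Matrix.SpecialLinearGroup.smul_def, Matrix.SpecialLinearGroup.coe_inv,
      Matrix.adjugate_fin_two, Matrix.vecMul, dotProduct, Fin.sum_univ_two] <;>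
    ring

theorem latticeRotation_eq_zero_iff (v : Fin 2 → ℤ) : latticeRotation v = 0 ↔ v = 0 := by
  have h : latticeRotation 0 = 0 := by ext i; fin_cases i <;> simp [latticeRotation]
  rw [← latticeRotation.injective.eq_iff (a := v), h]

/-- The elements of `SL(2, ℤ)` that fix a non-zero vector are unipotent, and
`g ↦ g 1 0 - g 0 1` embeds the stabilizer of the vector in `ℤ`. -/
theorem isAmenableGroup_stabilizer_of_ne_zero (v : Fin 2 → ℤ) (hv : v ≠ 0) :
    IsAmenableGroup (MulAction.stabilizer SL(2, ℤ) v) := by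
  obtain ⟨p, q, rfl⟩ : ∃ p q : ℤ, v = ![p, q] := ⟨v 0, v 1, by ext i; fin_cases i <;> rfl⟩
  have hpq : p ≠ 0 ∨ q ≠ 0 := by
    by_contra! h
    exact hv (by rw [h.1, h.2]; ext i; fin_cases i <;> rfl)
  have hmem (s : MulAction.stabilizer SL(2, ℤ) ![p, q]) :
      p * (s.1.1 0 0 - 1) = -(q * s.1.1 0 1) ∧ q * (s.1.1 0 0 - 1) = p * s.1.1 1 0 ∧
        s.1.1 1 1 = 2 - s.1.1 0 0 := by
    have h : Matrix.mulVec s.1.1 ![p, q] = ![p, q] := s.2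
    have h0 : s.1.1 0 0 * p + s.1.1 0 1 * q = p := by
      simpa [Matrix.mulVec, dotProduct] using congrFun h 0
    have h1 : s.1.1 1 0 * p + s.1.1 1 1 * q = q := by
      simpa [Matrix.mulVec, dotProduct] using congrFun h 1
    have hdet : s.1.1 0 0 * s.1.1 1 1 - s.1.1 0 1 * s.1.1 1 0 = 1 := by
      rw [← Matrix.det_fin_two, s.1.2]
    -- The eigenvalue `1` forces the trace to be `2`.
    have htr : s.1.1 1 1 = 2 - s.1.1 0 0 := by
      rcases hpq with hp | hq
      · refine mul_left_cancel₀ hp ?_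
        linear_combination s.1.1 0 1 * h1 - (s.1.1 1 1 - 1) * h0 + p * hdet
      · refine mul_left_cancel₀ hq ?_
        linear_combination s.1.1 1 0 * h0 - (s.1.1 0 0 - 1) * h1 + q * hdet
    refine ⟨by linarith, ?_, htr⟩
    rw [htr] at h1
    linarith
  let χ : MulAction.stabilizer SL(2, ℤ) ![p, q] →* Multiplicative ℤ :=
    { toFun := fun s => Multiplicative.ofAdd (s.1.1 1 0 - s.1.1 0 1)
      map_one' := by simp
      map_mul' := fun s t => by
        obtain ⟨s1, s2, s3⟩ := hmem s
        obtain ⟨t1, t2, t3⟩ := hmem t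
        rw [← ofAdd_add]
        congr 1
        change (s.1.1 * t.1.1) 1 0 - (s.1.1 * t.1.1) 0 1 = _
        have e1 : s.1.1 1 0 * (t.1.1 0 0 - 1) = (s.1.1 0 0 - 1) * t.1.1 1 0 := by
          rcases hpq with hp | hq
          · refine mul_left_cancel₀ hp ?_
            linear_combination (s.1.1 0 0 - 1) * t2 - (t.1.1 0 0 - 1) * s2
          · refine mul_left_cancel₀ hq ?_
            linear_combination s.1.1 1 0 * t2 - t.1.1 1 0 * s2
        have e2 : (s.1.1 0 0 - 1) * t.1.1 0 1 = s.1.1 0 1 * (t.1.1 0 0 - 1) := by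
          rcases hpq with hp | hq
          · refine mul_left_cancel₀ hp ?_
            linear_combination t.1.1 0 1 * s1 - s.1.1 0 1 * t1
          · refine mul_left_cancel₀ hq ?_
            linear_combination (s.1.1 0 0 - 1) * t1 - (t.1.1 0 0 - 1) * s1
        simp only [Matrix.mul_apply, Fin.sum_univ_two, s3, t3]
        linear_combination e1 - e2 }
  refine isAmenableGroup_multiplicative_int.of_injective χ
    ((injective_iff_map_eq_one χ).2 fun s hs => ?_)
  obtain ⟨s1, s2, s3⟩ := hmem s
  have hbc : s.1.1 1 0 - s.1.1 0 1 = 0 := congrArg Multiplicative.toAdd hs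
  have hpos : p ^ 2 + q ^ 2 ≠ 0 := by
    rcases hpq with h | h <;> positivity
  have h10 : s.1.1 1 0 = 0 := by
    refine (mul_eq_zero.1 ?_).resolve_left hpos
    linear_combination q * s1 - p * s2 + q ^ 2 * hbc
  have h01 : s.1.1 0 1 = 0 := by linarith
  have h00 : s.1.1 0 0 = 1 := by
    refine sub_eq_zero.1 ?_
    rcases hpq with h | h
    · exact (mul_eq_zero.1 (by rw [s1, h01]; ring)).resolve_left h
    · exact (mul_eq_zero.1 (by rw [s2, h10]; ring)).resolve_left h
  have h11 : s.1.1 1 1 = 1 := by rw [s3, h00]; norm_num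
  refine Subtype.ext (Subtype.ext ?_)
  ext i j
  fin_cases i <;> fin_cases j <;> simp [h00, h01, h10, h11]

theorem continuous_torusAction (g : SL(2, ℤ)) : Continuous (torusAction g) :=
  continuous_pi fun i => continuous_finsetSum Finset.univ fun j _ =>
    (continuous_apply j).zsmul (g.1 i j)

theorem torusAction_add (g : SL(2, ℤ)) (x y : UnitAddTorus (Fin 2)) :
    torusAction g (x + y) = torusAction g x + torusAction g y := by
  ext i
  change ∑ j, g.1 i j • (x j + y j) = ∑ j, g.1 i j • x j + ∑ j, g.1 i j • y j
  simp only [smul_add, Finset.sum_add_distrib]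

theorem measurePreserving_torusAction (g : SL(2, ℤ)) (μ : Measure (UnitAddTorus (Fin 2)))
    [μ.IsAddHaarMeasure] : MeasurePreserving (torusAction g) μ μ :=
  AddMonoidHom.measurePreserving (f := AddMonoidHom.mk' (torusAction g) (torusAction_add g))
    (continuous_torusAction g) (torusAction g).surjective rfl

theorem mFourier_torusAction (g : SL(2, ℤ)) (v : Fin 2 → ℤ) (x : UnitAddTorus (Fin 2)) :
    UnitAddTorus.mFourier v (torusAction g x) = UnitAddTorus.mFourier (Matrix.vecMul v g.1) x := by
  change ∏ i, fourier (v i) (∑ j, g.1 i j • x j) = ∏ i, fourier (Matrix.vecMul v g.1 i) (x i)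
  simp only [Fin.prod_univ_two, Fin.sum_univ_two, Matrix.vecMul, dotProduct, fourier_apply,
    smul_add, smul_smul, add_smul, AddCircle.toCircle_add, Circle.coe_mul]
  ring

/-- The volume of the torus is the product of the normalized Haar measures of the circles, the
measure with respect to which Mathlib expands functions on the torus into Fourier series. -/
theorem volume_unitAddTorus_eq_pi_haarAddCircle (d : Type*) [Fintype d] :
    (volume : Measure (UnitAddTorus d)) =
      Measure.pi fun _ : d => (AddCircle.haarAddCircle : Measure UnitAddCircle) := by
  have h : (volume : Measure UnitAddCircle) = AddCircle.haarAddCircle := by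
    rw [AddCircle.volume_eq_smul_haarAddCircle, ENNReal.ofReal_one, one_smul]
  rw [← h]
  rfl

/-- Under the Fourier transform, the action of a subgroup of `SL(2, ℤ)` on `L²(𝕋²)` becomes the
permutation representation on `ℓ²(ℤ²)` for the dual action, which `latticeRotation` identifies with
the natural one. Its stabilizers away from `0` are amenable. -/
theorem isStronglyErgodicAction_torusAction (Γ : Subgroup SL(2, ℤ)) (hΓ : ¬ IsAmenableGroup Γ) :
    IsStronglyErgodicAction (volume : Measure (UnitAddTorus (Fin 2)))
      (torusAction.comp Γ.subtype) := by
  rw [volume_unitAddTorus_eq_pi_haarAddCircle]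
  set μ : Measure (UnitAddTorus (Fin 2)) :=
    Measure.pi fun _ : Fin 2 => (AddCircle.haarAddCircle : Measure UnitAddCircle)
  have hmp (g : SL(2, ℤ)) : MeasurePreserving (torusAction g) μ μ :=
    measurePreserving_torusAction g μ
  refine ⟨fun g => hmp g, fun f hf hC hinv => ?_⟩
  obtain ⟨C, hC⟩ := hC
  have hL (n : ℕ) : MemLp (f n) 2 μ := MemLp.of_bound (hf n) C (hC n)
  have hLg (g : SL(2, ℤ)) (n : ℕ) : MemLp (fun x => f n (torusAction g x)) 2 μ :=
    (hL n).comp_measurePreserving (hmp g)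
  let b : HilbertBasis (Fin 2 → ℤ) ℂ (Lp ℂ 2 μ) := UnitAddTorus.mFourierBasis
  -- The Fourier transform, with frequencies relabelled by `latticeRotation`.
  let T : Lp ℂ 2 μ ≃ₗᵢ[ℂ] lp (fun _ : Fin 2 → ℤ => ℂ) 2 :=
    b.repr.trans (permRep (Equiv.Perm (Fin 2 → ℤ)) (Fin 2 → ℤ) latticeRotation⁻¹)
  have hT_apply (u : Lp ℂ 2 μ) (v : Fin 2 → ℤ) : T u v = b.repr u (latticeRotation v) := rfl
  have hT (u : UnitAddTorus (Fin 2) → ℂ) (hu : MemLp u 2 μ) (v : Fin 2 → ℤ) :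
      T (hu.toLp u) v = ∫ x, UnitAddTorus.mFourier (-latticeRotation v) x * u x ∂μ := by
    rw [hT_apply]
    refine (UnitAddTorus.mFourierBasis_repr (hu.toLp u) (latticeRotation v)).trans
      (integral_congr_ae ?_)
    filter_upwards [hu.coeFn_toLp] with x hx
    rw [hx, smul_eq_mul]
  have hT_action (g : SL(2, ℤ)) (n : ℕ) :
      T ((hLg g⁻¹ n).toLp _) = permRep SL(2, ℤ) (Fin 2 → ℤ) g (T ((hL n).toLp _)) := by
    ext v
    change _ = T ((hL n).toLp _) (g⁻¹ • v)
    rw [hT, hT, latticeRotation_inv_smul]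
    have hmeas : AEStronglyMeasurable
        (fun x => UnitAddTorus.mFourier (-latticeRotation v) x * f n (torusAction g⁻¹ x)) μ :=
      (UnitAddTorus.mFourier (-latticeRotation v)).continuous.aestronglyMeasurable.mul
        (hLg g⁻¹ n).aestronglyMeasurable
    have hmap := integral_map (μ := μ) (hmp g).measurable.aemeasurable
      (by rw [(hmp g).map_eq]; exact hmeas)
    rw [(hmp g).map_eq] at hmap
    rw [hmap]
    refine integral_congr_ae (Eventually.of_forall fun x => ?_)
    simp only [map_inv, Equiv.Perm.inv_def, Equiv.symm_apply_apply, mFourier_torusAction,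
      Matrix.neg_vecMul]
  have hnorm (u : UnitAddTorus (Fin 2) → ℂ) (hu : MemLp u 2 μ) :
      ‖T (hu.toLp u)‖ = (eLpNorm u 2 μ).toReal := by
    rw [T.norm_map, Lp.norm_toLp]
  have hξ := tendsto_norm_sub_single_of_asymptoticallyInvariant hΓ (0 : Fin 2 → ℤ)
    (fun g => smul_zero _)
    (fun v hv => isAmenableGroup_stabilizer_subgroup Γ (isAmenableGroup_stabilizer_of_ne_zero v hv))
    (fun n => T ((hL n).toLp _)) fun g => by
      have h := (ENNReal.tendsto_toReal ENNReal.zero_ne_top).comp (hinv g)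
      refine h.congr fun n => ?_
      have e : permRep Γ (Fin 2 → ℤ) g (T ((hL n).toLp _)) = T ((hLg g⁻¹ n).toLp _) :=
        (hT_action g n).symm
      rw [e, ← map_sub, ← MemLp.toLp_sub, hnorm]
      rfl
  have hconst (c : ℂ) : T ((memLp_const c).toLp fun _ : UnitAddTorus (Fin 2) => c) =
      lp.single 2 0 c := by
    have h0 : b 0 = (memLp_const (1 : ℂ)).toLp fun _ : UnitAddTorus (Fin 2) => (1 : ℂ) := by
      have : b 0 = UnitAddTorus.mFourierLp 2 0 := congrFun UnitAddTorus.coe_mFourierBasis 0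
      rw [this]
      refine Lp.ext ?_
      filter_upwards [UnitAddTorus.coeFn_mFourierLp (d := Fin 2) 2 0,
        (memLp_const (μ := μ) (p := 2) (1 : ℂ)).coeFn_toLp] with x h1 h2
      rw [h1, h2, UnitAddTorus.mFourier_zero]
      rfl
    have hc : (memLp_const c).toLp (fun _ : UnitAddTorus (Fin 2) => c) = c • b 0 := by
      rw [h0, ← MemLp.toLp_const_smul]
      congr 1
      ext x
      simp
    have hbc : b.repr (c • b 0) = lp.single 2 0 c := by
      rw [map_smul, b.repr_self, ← lp.single_smul, smul_eq_mul, mul_one]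
    ext v
    rw [hT_apply, hc, hbc]
    simp only [lp.single_apply, Pi.single_apply, latticeRotation_eq_zero_iff]
  have hfin (n : ℕ) : MemLp (fun x => f n x - ∫ y, f n y ∂μ) 2 μ := (hL n).sub (memLp_const _)
  have hreal : Tendsto (fun n => (eLpNorm (fun x => f n x - ∫ y, f n y ∂μ) 2 μ).toReal) atTop
      (𝓝 0) := by
    refine hξ.congr fun n => ?_
    have e : T ((hL n).toLp _) 0 = ∫ y, f n y ∂μ := by
      rw [hT, (latticeRotation_eq_zero_iff 0).2 rfl, neg_zero,
        UnitAddTorus.mFourier_zero]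
      simp
    rw [e, ← hconst, ← map_sub, ← MemLp.toLp_sub, hnorm]
    rfl
  have := ENNReal.tendsto_ofReal hreal
  rw [ENNReal.ofReal_zero] at this
  exact this.congr fun n => ENNReal.ofReal_toReal (hfin n).eLpNorm_ne_top

/-! ### Non-amenable groups and their amenable subgroups -/

theorem mainTheorem11 {G : Type*} [Group G] (hG : ¬ IsAmenableGroup G) :
    (¬ WeaklyContained (trivialRep G)
      (sumQuasiRegularRep {H : Subgroup G | IsAmenableGroup H})) ∧
    (¬ WeaklyContained (trivialRep G)
      (tensorTrivialRep (sumQuasiRegularRep {H : Subgroup G | IsAmenableGroup H})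
        (lp (fun _ : ℕ => ℂ) 2))) ∧
    HasPropertyTau G {H : Subgroup G | IsAmenableGroup H} ∧
    (∀ {N : Type*} [Group N] [MulDistribMulAction G N],
      (∀ h : N, h ≠ 1 → IsAmenableGroup (MulAction.stabilizer G h)) →
      ∀ Γ : Subgroup G, ¬ IsAmenableGroup Γ →
        IsStronglyErgodicOn (groupVN N) (groupVNTrace N)
          ((groupVNAction G N).comp Γ.subtype)) ∧
    (∀ Γ : Subgroup SL(2, ℤ), ¬ IsAmenableGroup Γ →
      IsStronglyErgodicAction (volume : Measure (UnitAddTorus (Fin 2)))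
        (torusAction.comp Γ.subtype)) := by
  refine ⟨not_weaklyContained_sumQuasiRegularRep hG,
    fun h => not_weaklyContained_sumQuasiRegularRep hG h.of_tensorTrivialRep,
    hasPropertyTau_amenableSubgroups hG, ?_, isStronglyErgodicAction_torusAction⟩
  intro N _ _ hs Γ hΓ
  exact isStronglyErgodicOn_groupVN hs Γ hΓ
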